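/- **Definitions.** An $\mathsf{roABP}$ over a field $\mathbb F$ in the variable order $\pi$ (a permutation of the $n$ variables) is a layered directed graph with $n+1$ layers of vertices, the first consisting only of a source $s$ and the last only of a sink $t$. Edges go from each layer to the next, and an edge of the $i$-th layer of edges is labelled by a univariate polynomial in $x_{\pi(i)}$. The program computes $\sum_{\gamma : s \rightsquigarrow t} \prod_{e\in\gamma} \mathrm{label}(e)$. Its width is the maximal number of vertices in a layer. The degree of a polynomial is its total degree. A finite graph $G=(V,E)$ has edge expansion at least $h$ if at least $h|S|$ edges leave every $S\subseteq V$ with $|S|\le |V|/2$. For a graph $G$ with vertices $1,\dots,n-1$ and $d\in\mathbb N$ define the polynomials, in the $n$ variables $x_1,\dots,x_{n-1},z$, $$Q_{G}=\prod_{\{i,j\}\in E}\bigl(1+x_ix_j+\cdots+(x_ix_j)^{d-1}\bigr),\qquad g=Q_{G}+z,\qquad f=g\cdot\prod_{\{i,j\}\in E}(x_ix_j-1).$$ **Theorem (roABP factor non-closure).** There are natural numbers $k$, $C\ge 1$ and real numbers $h,c>0$ such that for every $n\ge 3$ there is a simple graph $G$ on $n-1$ vertices, of maximum degree at most $k$ and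 edge expansion at least $h$, with the following property. For every field $\mathbb F$ and every $d\ge n$, the polynomials $f,g\in\mathbb F[x_1,\dots,x_{n-1},z]$ above satisfy, with $w:=2^{Cn}$: 1. $f$ has degree exactly $2d|E|$, so that $d\le\deg f\le k\,n\,d$, and degree at most $kd$ in each variable; 2. in every variable order, $f$ is computed by an $\mathsf{roABP}$ of width at most $w$; 3. $g$ is an irreducible factor of $f$; 4. in every variable order, each $\mathsf{roABP}$ computing $g$ has width at least $w^{\,c\log_2(\deg f)}$; in particular at least $w^{\,c\log_2 d}$. -/

import Mathlib

/-- A read-once oblivious algebraic branching program with `n` layers of edges. It has `n + 1`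
layers of vertices, the first consisting only of the source and the last only of the sink. There is
an edge from every vertex of a layer to every vertex of the next one; it is labelled by a univariate
polynomial, and the label `0` stands for a missing edge. The variable that is read in each layer is
supplied by the variable order in `RoABP.eval`. -/
structure RoABP (F : Type*) [Field F] (n : ℕ) where
  /-- the number of vertices of each layer -/
  size : Fin (n + 1) → ℕ
  /-- the first layer consists of the source -/
  size_first : size 0 = 1
  /-- the last layer consists of the sink -/
  size_last : size (Fin.last n) = 1
  /-- the label of the edge from a vertex of layer `i` to a vertex of layer `i + 1` -/
  label : (i : Fin n) → Fin (size i.castSucc) → Fin (size i.succ) → Polynomial F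

namespace RoABP

variable {F : Type*} [Field F] {n : ℕ}

/-- The width: the maximal number of vertices in a layer. -/
def width (B : RoABP F n) : ℕ := Finset.univ.sup B.size

/-- The polynomial computed by the program in the variable order `π`: the sum, over all paths from
the source to the sink, of the product of the edge labels along the path, where the labels of the
`i`-th layer of edges are polynomials in the variable `x_{π i}`. A path is given by its vertex in
every layer. -/
noncomputable def eval (B : RoABP F n) (π : Equiv.Perm (Fin n)) : MvPolynomial (Fin n) F :=
  ∑ p : (i : Fin (n + 1)) → Fin (B.size i),
    ∏ i : Fin n,
      Polynomial.aeval (MvPolynomial.X (π i)) (B.label i (p i.castSucc) (p i.succ))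

end RoABP

/-- `G` has edge expansion at least `h`: at least `h * |S|` edges leave every set `S` that contains
at most half of the vertices. -/
def IsEdgeExpander {V : Type*} [Fintype V] [DecidableEq V] (G : SimpleGraph V)
    [DecidableRel G.Adj] (h : ℝ) : Prop :=
  ∀ S : Finset V, 2 * S.card ≤ Fintype.card V → h * S.card ≤ ((G.interedges S Sᶜ).card : ℝ)

section GraphPolynomials

variable (F : Type*) [Field F] {m : ℕ}

/-- The monomial `x_i x_j` of an edge `{i, j}`. The variables are `x_0, …, x_{m-1}`, one for each
vertex, and one more variable `z`, which is the last of the `m + 1` variables. -/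
noncomputable def edgeMonomial (e : Sym2 (Fin m)) : MvPolynomial (Fin (m + 1)) F :=
  (e.map fun i => (MvPolynomial.X i.castSucc : MvPolynomial (Fin (m + 1)) F)).mul

variable (G : SimpleGraph (Fin m)) [DecidableRel G.Adj]

/-- `Q_G = ∏_{ij ∈ E} (1 + x_i x_j + ⋯ + (x_i x_j)^(d-1))`. -/
noncomputable def graphQ (d : ℕ) : MvPolynomial (Fin (m + 1)) F :=
  ∏ e ∈ G.edgeFinset, ∑ a ∈ Finset.range d, edgeMonomial F e ^ a

/-- `Q_G + z`. -/
noncomputable def hardFactor (d : ℕ) : MvPolynomial (Fin (m + 1)) F :=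
  graphQ F G d + MvPolynomial.X (Fin.last m)

/-- `(Q_G + z) ∏_{ij ∈ E} (x_i x_j - 1)`. -/
noncomputable def easyProduct (d : ℕ) : MvPolynomial (Fin (m + 1)) F :=
  hardFactor F G d * ∏ e ∈ G.edgeFinset, (edgeMonomial F e - 1)

end GraphPolynomials

/-!
The product is easy because multiplication by the `x_i x_j - 1` telescopes the geometric sums:
`f = ∏ ((x_i x_j) ^ d - 1) + z ∏ (x_i x_j - 1)` (`easyProduct_eq`). Expanding both products gives a
sum of `2 ^ (|E| + 1)` monomials, and a sum of `W` products of univariate polynomials has a program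
of width `W` in every order (`RoABP.exists_eval_eq_sum_prod`). Here `|E|` is linear in the number of
vertices, as the degrees are bounded.

The factor `Q_G + z` is hard because of the expansion of `G`. Given a variable order, cut it so that
half of the vertices come before the cut. Linearly many edges cross the cut, hence so does an induced
matching `M` of linear size (`SimpleGraph.exists_induced_matching`). Setting all other variables to
`0` leaves `∏ (1 + x y + ⋯ + (x y) ^ (d - 1))`, over the edges of `M`. Its matrix of coefficients,
with rows indexed by the monomials before the cut and columns by those after it, contains an identity
matrix of size `d ^ |M|`. This matrix factors through the vertices of the layer at the cut, so the
width is at least `d ^ |M|` (`RoABP.pow_card_le_width`). As `d` exceeds the number of vertices,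
`log d` and `log (deg f)` agree up to a constant factor.

The factor is irreducible as it is the image of `z` under the automorphism `z ↦ Q_G + z`.

The graphs are unions of eight random permutations. A union bound shows that, with positive
probability, every set `S` of at most half of the vertices has more than `⌊|S| / 32⌋` neighbours
outside of it (`exists_perms_not_isTrapped`).
-/

/-! ### Bounded degree expanders from random permutations -/

/-- The simple graph that joins two distinct vertices if one of the given permutations maps one of
them to the other. -/
def permGraph {ι V : Type*} (σ : ι → Equiv.Perm V) : SimpleGraph V :=
  SimpleGraph.fromRel fun i j => ∃ a, σ a i = j

open Classical in
theorem permGraph_degree_le {ι V : Type*} [Fintype ι] [Fintype V] (σ : ι → Equiv.Perm V)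
    (v : V) [Fintype ((permGraph σ).neighborSet v)] :
    (permGraph σ).degree v ≤ 2 * Fintype.card ι := by
  have hsub : (permGraph σ).neighborFinset v ⊆
      Finset.univ.image (fun a => σ a v) ∪ Finset.univ.image (fun a => (σ a).symm v) := by
    intro w hw
    rw [SimpleGraph.mem_neighborFinset, permGraph, SimpleGraph.fromRel_adj] at hw
    rw [Finset.mem_union, Finset.mem_image, Finset.mem_image]
    rcases hw.2 with ⟨a, ha⟩ | ⟨a, ha⟩
    · exact Or.inl ⟨a, Finset.mem_univ a, ha⟩
    · exact Or.inr ⟨a, Finset.mem_univ a, by rw [← ha, Equiv.symm_apply_apply]⟩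
  rw [← SimpleGraph.card_neighborFinset_eq_degree]
  refine (Finset.card_le_card hsub).trans ((Finset.card_union_le _ _).trans ?_)
  have h1 := Finset.card_image_le (s := (Finset.univ : Finset ι)) (f := fun a => σ a v)
  have h2 := Finset.card_image_le (s := (Finset.univ : Finset ι)) (f := fun a => (σ a).symm v)
  rw [Finset.card_univ] at h1 h2
  lia

/-- Every vertex outside `S` that some permutation reaches from `S` accounts for its own edge
leaving `S`. -/
theorem permGraph_card_interedges {ι V : Type*} [Fintype ι] [Fintype V] [DecidableEq V]
    (σ : ι → Equiv.Perm V) [DecidableRel (permGraph σ).Adj] (S : Finset V) :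
    ((Finset.univ.biUnion fun a => S.image (σ a)) \ S).card ≤
      ((permGraph σ).interedges S Sᶜ).card := by
  refine (Finset.card_le_card ?_).trans
    (Finset.card_image_le (s := (permGraph σ).interedges S Sᶜ) (f := Prod.snd))
  intro w hw
  simp only [Finset.mem_sdiff, Finset.mem_biUnion, Finset.mem_univ, true_and,
    Finset.mem_image] at hw
  obtain ⟨⟨a, v, hv, rfl⟩, hw⟩ := hw
  refine Finset.mem_image.2 ⟨(v, σ a v), ?_, rfl⟩
  rw [SimpleGraph.mem_interedges_iff]
  refine ⟨hv, Finset.mem_compl.2 hw, ?_⟩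
  rw [permGraph, SimpleGraph.fromRel_adj]
  exact ⟨fun h => hw ((show v = σ a v from h) ▸ hv), Or.inl ⟨a, rfl⟩⟩

section Counting

variable {V : Type*} [Fintype V] [DecidableEq V]

/-- A random permutation maps `S` to a uniformly distributed set of the same size. -/
theorem card_perm_image_eq_mul_choose (S R : Finset V) (h : R.card = S.card) :
    (Finset.univ.filter fun σ : Equiv.Perm V => S.image σ = R).card *
      (Fintype.card V).choose S.card = (Fintype.card V).factorial := by
  have key : ∀ R' ∈ Finset.univ.powersetCard S.card,
      (Finset.univ.filter fun σ : Equiv.Perm V => S.image σ = R').card =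
        (Finset.univ.filter fun σ : Equiv.Perm V => S.image σ = R).card := by
    intro R' hR'
    have hc : R'.card = R.card := by rw [(Finset.mem_powersetCard.1 hR').2, h]
    -- composing with a permutation that carries `R'` to `R` identifies the two sets
    obtain ⟨τ, hτ⟩ : ∃ τ : Equiv.Perm V, R'.image τ = R := by
      let e : {x // x ∈ R'} ≃ {x // x ∈ R} := Finset.equivOfCardEq hc
      refine ⟨e.extendSubtype, ?_⟩
      apply Finset.eq_of_subset_of_card_le
      · intro y hy
        obtain ⟨x, hx, rfl⟩ := Finset.mem_image.1 hy
        exact e.extendSubtype_mem x hx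
      · rw [Finset.card_image_of_injective _ (Equiv.injective _), hc]
    refine Finset.card_bij (fun σ _ => τ * σ) ?_ ?_ ?_
    · intro σ hσ
      rw [Finset.mem_filter] at hσ ⊢
      refine ⟨Finset.mem_univ _, ?_⟩
      rw [Equiv.Perm.coe_mul, ← Finset.image_image, hσ.2, hτ]
    · intro a _ b _ hab
      exact mul_left_cancel hab
    · intro σ hσ
      refine ⟨τ⁻¹ * σ, ?_, mul_inv_cancel_left _ _⟩
      rw [Finset.mem_filter] at hσ ⊢
      refine ⟨Finset.mem_univ _, ?_⟩
      rw [Equiv.Perm.coe_mul, ← Finset.image_image, hσ.2, ← hτ, Finset.image_image,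
        ← Equiv.Perm.coe_mul, inv_mul_cancel, Equiv.Perm.coe_one, Finset.image_id]
  have hsum := Finset.card_eq_sum_card_fiberwise
    (s := (Finset.univ : Finset (Equiv.Perm V))) (t := Finset.univ.powersetCard S.card)
    (f := fun σ : Equiv.Perm V => S.image σ) (by
      intro σ _
      exact Finset.mem_coe.2 (Finset.mem_powersetCard.2
        ⟨Finset.subset_univ _, Finset.card_image_of_injective _ σ.injective⟩))
  rw [Finset.sum_congr rfl key, Finset.sum_const, Finset.card_powersetCard, Finset.card_univ,
    Finset.card_univ, Fintype.card_perm, smul_eq_mul] at hsum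
  rw [hsum, mul_comm]

theorem card_perm_image_subset_mul_choose (S T : Finset V) :
    (Finset.univ.filter fun σ : Equiv.Perm V => S.image σ ⊆ T).card *
      (Fintype.card V).choose S.card = T.card.choose S.card * (Fintype.card V).factorial := by
  have hsum := Finset.card_eq_sum_card_fiberwise
    (s := Finset.univ.filter fun σ : Equiv.Perm V => S.image σ ⊆ T) (t := T.powersetCard S.card)
    (f := fun σ : Equiv.Perm V => S.image σ) (by
      intro σ hσ
      exact Finset.mem_coe.2 (Finset.mem_powersetCard.2
        ⟨(Finset.mem_filter.1 hσ).2, Finset.card_image_of_injective _ σ.injective⟩))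
  rw [hsum, Finset.sum_mul, ← Finset.card_powersetCard, ← smul_eq_mul, ← Finset.sum_const]
  refine Finset.sum_congr rfl fun R hR => ?_
  rw [Finset.mem_powersetCard] at hR
  rw [← card_perm_image_eq_mul_choose S R hR.2, Finset.filter_filter]
  congr 3
  ext σ
  exact ⟨fun h => h.2, fun h => ⟨h ▸ hR.1, h⟩⟩

end Counting

theorem choose_le_choose_of_two_mul_le {m r s : ℕ} (hrs : r ≤ s) (hs : 2 * s ≤ m) :
    m.choose r ≤ m.choose s := by
  induction s, hrs using Nat.le_induction with
  | base => exact le_rfl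
  | succ s _ ih => exact (ih (by lia)).trans (Nat.choose_le_succ_of_lt_half_left (by lia))

theorem two_pow_le_choose {m s : ℕ} (h : 2 * s ≤ m) : 2 ^ s ≤ m.choose s := by
  refine le_trans ?_ (Nat.choose_le_choose s h)
  induction s with
  | zero => simp
  | succ s ih =>
    have h1 := Nat.succ_mul_centralBinom_succ s
    have h2 := ih (by lia)
    rw [← Nat.centralBinom_eq_two_mul_choose] at h2 ⊢
    rw [pow_succ]
    nlinarith

/-- The quotient `32` is what makes this estimate work: with `u = s / 32`, it follows from
`(s + u).choose s * 16 ^ s ≤ 17 ^ (s + u)`. -/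
theorem choose_sq_le_two_pow (s : ℕ) : (s + s / 32).choose s ^ 2 ≤ 2 ^ s := by
  obtain ⟨u, r, hr, rfl⟩ : ∃ u r, r < 32 ∧ s = 32 * u + r :=
    ⟨s / 32, s % 32, Nat.mod_lt _ (by norm_num), (Nat.div_add_mod s 32).symm⟩
  have hu : (32 * u + r) / 32 = u := by lia
  rw [hu]
  set s := 32 * u + r with hs
  -- one term of the binomial expansion of `(16 + 1) ^ (s + u)`
  have h1 : 16 ^ s * (s + u).choose s ≤ 17 ^ (s + u) := by
    have := Finset.single_le_sum (f := fun i => 16 ^ i * 1 ^ (s + u - i) * ((s + u).choose i : ℕ))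
      (fun i _ => Nat.zero_le _) (Finset.mem_range.2 (show s < s + u + 1 by lia))
    have hadd := add_pow 16 1 (s + u)
    simp only [Nat.cast_id] at hadd
    rwa [← hadd, one_pow, mul_one] at this
  have h2 : (16 ^ s) ^ 2 * (s + u).choose s ^ 2 ≤ (17 ^ (s + u)) ^ 2 := by
    rw [← mul_pow]; exact Nat.pow_le_pow_left h1 2
  have h3 : (17 ^ (s + u)) ^ 2 ≤ (16 ^ s) ^ 2 * 2 ^ s := by
    calc (17 ^ (s + u)) ^ 2 = (17 ^ 66) ^ u * (17 ^ 2) ^ r := by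
          rw [← pow_mul, ← pow_mul, ← pow_mul, ← pow_add]; congr 1; lia
      _ ≤ (512 ^ 32) ^ u * 512 ^ r :=
          Nat.mul_le_mul (Nat.pow_le_pow_left (by norm_num) u) (Nat.pow_le_pow_left (by norm_num) r)
      _ = (16 ^ s) ^ 2 * 2 ^ s := by
          rw [← pow_mul, ← pow_add, ← hs, ← pow_mul, mul_comm s 2, pow_mul, ← mul_pow]; norm_num
  exact Nat.le_of_mul_le_mul_left (h2.trans h3) (by positivity)

/-- At most `⌊|S| / 32⌋` points outside `S` are images of points of `S` under the permutations in the
tuple `σ`. -/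
def IsTrapped {ι V : Type*} [Fintype ι] [DecidableEq V] (σ : ι → Equiv.Perm V) (S : Finset V) :
    Prop :=
  ((Finset.univ.biUnion fun a => S.image (σ a)) \ S).card ≤ S.card / 32

open Classical in
/-- The probability that a set of size `s` is trapped by eight random permutations is at most
`1 / (m.choose s) ^ 3`. If it is trapped, all eight map `S` into `S ∪ U` for some set `U` of size
`s / 32`. For a given `U`, each does so with probability at most
`(s + s / 32).choose s / m.choose s ≤ (m.choose s) ^ (-1 / 2)`, and there are at most `m.choose s`
sets `U`. -/
theorem card_isTrapped_mul_le {m : ℕ} (S : Finset (Fin m)) (hS : 2 * S.card ≤ m) :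
    (Finset.univ.filter fun σ : Fin 8 → Equiv.Perm (Fin m) => IsTrapped σ S).card *
      m.choose S.card ^ 3 ≤ m.factorial ^ 8 := by
  set s := S.card with hs
  set N := m.choose s with hN
  have hNpos : 0 < N := Nat.choose_pos (by lia)
  have hsub : (Finset.univ.filter fun σ : Fin 8 → Equiv.Perm (Fin m) => IsTrapped σ S) ⊆
      (Finset.univ.powersetCard (s / 32)).biUnion fun U =>
        Fintype.piFinset fun _ : Fin 8 =>
          Finset.univ.filter fun σ : Equiv.Perm (Fin m) => S.image σ ⊆ S ∪ U := by
    intro σ hσ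
    have hσ' : ((Finset.univ.biUnion fun a => S.image (σ a)) \ S).card ≤ s / 32 :=
      (Finset.mem_filter.1 hσ).2
    obtain ⟨U, hU, hUc⟩ := Finset.exists_superset_card_eq hσ'
      (by rw [Fintype.card_fin]; lia)
    refine Finset.mem_biUnion.2
      ⟨U, Finset.mem_powersetCard.2 ⟨Finset.subset_univ _, hUc⟩, ?_⟩
    refine Fintype.mem_piFinset.2 fun a => Finset.mem_filter.2 ⟨Finset.mem_univ _, ?_⟩
    intro x hx
    rw [Finset.mem_union]
    by_cases hxS : x ∈ S
    · exact Or.inl hxS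
    · exact Or.inr (hU (Finset.mem_sdiff.2
        ⟨Finset.mem_biUnion.2 ⟨a, Finset.mem_univ a, hx⟩, hxS⟩))
  have hU : ∀ U ∈ (Finset.univ : Finset (Fin m)).powersetCard (s / 32),
      (Fintype.piFinset fun _ : Fin 8 => Finset.univ.filter
        fun σ : Equiv.Perm (Fin m) => S.image σ ⊆ S ∪ U).card * N ^ 4 ≤ m.factorial ^ 8 := by
    intro U hU
    rw [Fintype.card_piFinset, Finset.prod_const, Finset.card_univ, Fintype.card_fin]
    have h1 := card_perm_image_subset_mul_choose S (S ∪ U)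
    rw [Fintype.card_fin, ← hs, ← hN] at h1
    set A := (Finset.univ.filter fun σ : Equiv.Perm (Fin m) => S.image σ ⊆ S ∪ U).card
    have h2 : (S ∪ U).card.choose s ^ 2 ≤ N := by
      have : (S ∪ U).card ≤ s + s / 32 := by
        rw [← (Finset.mem_powersetCard.1 hU).2]; exact Finset.card_union_le S U
      exact (Nat.pow_le_pow_left (Nat.choose_le_choose s this) 2).trans
        ((choose_sq_le_two_pow s).trans (two_pow_le_choose hS))
    have h3 : A ^ 2 * N ≤ m.factorial ^ 2 := by
      refine Nat.le_of_mul_le_mul_left (c := N) ?_ hNpos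
      calc N * (A ^ 2 * N) = (A * N) ^ 2 := by ring
        _ = (S ∪ U).card.choose s ^ 2 * m.factorial ^ 2 := by rw [h1, mul_pow]
        _ ≤ N * m.factorial ^ 2 := Nat.mul_le_mul_right _ h2
    calc A ^ 8 * N ^ 4 = (A ^ 2 * N) ^ 4 := by ring
      _ ≤ (m.factorial ^ 2) ^ 4 := Nat.pow_le_pow_left h3 4
      _ = m.factorial ^ 8 := by ring
  have hcU : m.choose (s / 32) ≤ N := choose_le_choose_of_two_mul_le (by lia) hS
  refine Nat.le_of_mul_le_mul_left (c := N) ?_ hNpos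
  calc N * (_ * N ^ 3) = _ * N ^ 4 := by ring
    _ ≤ _ := Nat.mul_le_mul_right _ ((Finset.card_le_card hsub).trans Finset.card_biUnion_le)
    _ = ∑ U ∈ (Finset.univ : Finset (Fin m)).powersetCard (s / 32), _ := Finset.sum_mul _ _ _
    _ ≤ _ := Finset.sum_le_sum hU
    _ = m.choose (s / 32) * m.factorial ^ 8 := by
      rw [Finset.sum_const, Finset.card_powersetCard, Finset.card_univ, Fintype.card_fin,
        smul_eq_mul]
    _ ≤ N * m.factorial ^ 8 := Nat.mul_le_mul_right _ hcU

open Classical in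
/-- The union bound over all nonempty sets `S` with `2 * |S| ≤ m`: those of a given size contribute
at most `1 / m ^ 2` to the probability, and there are at most `m / 2` sizes. -/
theorem exists_perms_not_isTrapped {m : ℕ} (hm : 2 ≤ m) :
    ∃ σ : Fin 8 → Equiv.Perm (Fin m),
      ∀ S : Finset (Fin m), S.Nonempty → 2 * S.card ≤ m → ¬ IsTrapped σ S := by
  by_contra! hcon
  set I := Finset.Icc 1 (m / 2)
  have hcover : (Finset.univ : Finset (Fin 8 → Equiv.Perm (Fin m))) ⊆
      I.biUnion fun s => (Finset.univ.powersetCard s).biUnion fun S =>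
        Finset.univ.filter fun σ => IsTrapped σ S := by
    intro σ _
    obtain ⟨S, hne, hS, hT⟩ := hcon σ
    have := hne.card_pos
    exact Finset.mem_biUnion.2 ⟨S.card, Finset.mem_Icc.2 ⟨this, by lia⟩,
      Finset.mem_biUnion.2 ⟨S, Finset.mem_powersetCard.2 ⟨Finset.subset_univ _, rfl⟩,
        Finset.mem_filter.2 ⟨Finset.mem_univ _, hT⟩⟩⟩
  have hs : ∀ s ∈ I, ((Finset.univ.powersetCard s).biUnion fun S : Finset (Fin m) =>
      Finset.univ.filter fun σ : Fin 8 → Equiv.Perm (Fin m) => IsTrapped σ S).card * m ^ 2 ≤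
        m.factorial ^ 8 := by
    intro s hsI
    have hsI := Finset.mem_Icc.1 hsI
    have hle : m ≤ m.choose s := by
      have := choose_le_choose_of_two_mul_le (m := m) hsI.1 (by lia)
      rwa [Nat.choose_one_right] at this
    have hpos : 0 < m.choose s := by lia
    refine (Nat.mul_le_mul_left _ (Nat.pow_le_pow_left hle 2)).trans ?_
    refine Nat.le_of_mul_le_mul_left (c := m.choose s) ?_ hpos
    calc m.choose s * (_ * m.choose s ^ 2) = _ * m.choose s ^ 3 := by ring
      _ ≤ _ := Nat.mul_le_mul_right _ Finset.card_biUnion_le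
      _ = ∑ S ∈ (Finset.univ : Finset (Fin m)).powersetCard s, _ := Finset.sum_mul _ _ _
      _ ≤ ∑ S ∈ (Finset.univ : Finset (Fin m)).powersetCard s, m.factorial ^ 8 := by
        refine Finset.sum_le_sum fun S hS => ?_
        have hSc := (Finset.mem_powersetCard.1 hS).2
        rw [← hSc]
        exact card_isTrapped_mul_le S (by lia)
      _ = m.choose s * m.factorial ^ 8 := by
        rw [Finset.sum_const, Finset.card_powersetCard, Finset.card_univ, Fintype.card_fin,
          smul_eq_mul]
  have htot := (Finset.card_le_card hcover).trans Finset.card_biUnion_le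
  rw [Finset.card_univ, Fintype.card_pi_const, Fintype.card_perm, Fintype.card_fin] at htot
  have hfin : m.factorial ^ 8 * m ^ 2 ≤ (m / 2) * m.factorial ^ 8 := by
    refine (Nat.mul_le_mul_right _ htot).trans ?_
    rw [Finset.sum_mul]
    refine (Finset.sum_le_sum hs).trans_eq ?_
    rw [Finset.sum_const, Nat.card_Icc, smul_eq_mul, Nat.add_sub_cancel]
  have hpos : 0 < m.factorial ^ 8 := pow_pos (Nat.factorial_pos m) 8
  rw [mul_comm] at hfin
  have := Nat.le_of_mul_le_mul_right hfin hpos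
  nlinarith [Nat.div_le_self m 2]

/-- Bounded degree expanders exist on every number of vertices. -/
theorem exists_edgeExpander {m : ℕ} (hm : 2 ≤ m) :
    ∃ (G : SimpleGraph (Fin m)) (_ : DecidableRel G.Adj),
      (∀ v, G.degree v ≤ 16) ∧ IsEdgeExpander G (1 / 32) := by
  classical
  obtain ⟨σ, hσ⟩ := exists_perms_not_isTrapped hm
  refine ⟨permGraph σ, Classical.decRel _, fun v => ?_, fun S hS => ?_⟩
  · simpa using permGraph_degree_le σ v
  · rw [Fintype.card_fin] at hS
    rcases S.eq_empty_or_nonempty with rfl | hne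
    · simp
    have h1 := hσ S hne hS
    rw [IsTrapped, not_le] at h1
    have h2 := permGraph_card_interedges σ S
    have h3 : S.card ≤ 32 * ((permGraph σ).interedges S Sᶜ).card := by lia
    have h4 : (S.card : ℝ) ≤ 32 * (((permGraph σ).interedges S Sᶜ).card : ℝ) := by
      exact_mod_cast h3
    linarith

/-! ### The width of read-once oblivious programs -/

namespace RoABP

/-- Cutting the paths of a layered graph at layer `t` writes the sum over all paths as a sum, over
the vertices `v` of that layer, of a product of a part that comes from the labels before the cut
and a part that comes from the labels after it. The weights `w` on the first layer make the
statement inductive. -/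
theorem exists_sum_paths_eq_sum_mul {F A : Type*} [CommSemiring F] [CommSemiring A] [Algebra F A]
    (S T : Subalgebra F A) {n : ℕ} (size : Fin (n + 1) → ℕ)
    (lab : (i : Fin n) → Fin (size i.castSucc) → Fin (size i.succ) → A) (w : Fin (size 0) → A)
    (t : Fin (n + 1)) (hw : ∀ v, w v ∈ S)
    (hS : ∀ i : Fin n, i.castSucc < t → ∀ a b, lab i a b ∈ S)
    (hT : ∀ i : Fin n, t ≤ i.castSucc → ∀ a b, lab i a b ∈ T) :
    ∃ L R : Fin (size t) → A, (∀ v, L v ∈ S) ∧ (∀ v, R v ∈ T) ∧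
      ∑ p : (i : Fin (n + 1)) → Fin (size i), w (p 0) * ∏ i, lab i (p i.castSucc) (p i.succ) =
        ∑ v, L v * R v := by
  induction n with
  | zero =>
    obtain rfl : t = 0 := Fin.fin_one_eq_zero t
    refine ⟨w, fun _ => 1, hw, fun _ => one_mem _, ?_⟩
    rw [← (Fin.consEquiv fun i => Fin (size i)).sum_comp, Fintype.sum_prod_type]
    refine Finset.sum_congr rfl fun v _ => ?_
    simp [Fin.consEquiv]
  | succ n ih =>
    rw [← (Fin.consEquiv fun i => Fin (size i)).sum_comp, Fintype.sum_prod_type]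
    have hterm : ∀ (v : Fin (size 0)) (q : (i : Fin (n + 1)) → Fin (size i.succ)),
        w ((Fin.consEquiv fun i => Fin (size i)) (v, q) 0) *
            ∏ i, lab i ((Fin.consEquiv fun i => Fin (size i)) (v, q) i.castSucc)
              ((Fin.consEquiv fun i => Fin (size i)) (v, q) i.succ) =
          w v * (lab 0 v (q 0) * ∏ i : Fin n, lab i.succ (q i.castSucc) (q i.succ)) := by
      intro v q
      rw [Fin.prod_univ_succ]
      rfl
    simp only [hterm]
    induction t using Fin.cases with
    | zero =>
      refine ⟨w, fun v => ∑ q : (i : Fin (n + 1)) → Fin (size i.succ),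
        lab 0 v (q 0) * ∏ i : Fin n, lab i.succ (q i.castSucc) (q i.succ), hw, fun v => ?_, ?_⟩
      · exact sum_mem fun q _ => mul_mem (hT 0 (Fin.zero_le _) _ _)
          (prod_mem fun i _ => hT i.succ (Fin.zero_le _) _ _)
      · exact Finset.sum_congr rfl fun v _ => (Finset.mul_sum _ _ _).symm
    | succ t =>
      obtain ⟨L, R, hL, hR, h⟩ := ih (fun i => size i.succ) (fun i => lab i.succ)
        (fun b => ∑ v, w v * lab 0 v b) t
        (fun b => sum_mem fun v _ => mul_mem (hw v) (hS 0 (Fin.succ_pos t) _ _))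
        (fun i hi => hS i.succ (Fin.succ_lt_succ_iff.2 hi))
        (fun i hi => hT i.succ (Fin.succ_le_succ_iff.2 hi))
      refine ⟨L, R, hL, hR, ?_⟩
      rw [← h, Finset.sum_comm]
      refine Finset.sum_congr rfl fun q _ => ?_
      rw [Finset.sum_mul]
      exact Finset.sum_congr rfl fun v _ => (mul_assoc _ _ _).symm

variable {F : Type*} [Field F] {n : ℕ}

/-- The image of the computed polynomial under a homomorphism that maps the variables read before
layer `t` to the subalgebra `S` and the other ones to the subalgebra `T`. -/
theorem exists_map_eval_eq_sum_mul {A : Type*} [CommRing A] [Algebra F A]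
    (Φ : MvPolynomial (Fin n) F →ₐ[F] A) (S T : Subalgebra F A) (π : Equiv.Perm (Fin n))
    (B : RoABP F n) (t : Fin (n + 1))
    (hS : ∀ i : Fin n, i.castSucc < t → Φ (MvPolynomial.X (π i)) ∈ S)
    (hT : ∀ i : Fin n, t ≤ i.castSucc → Φ (MvPolynomial.X (π i)) ∈ T) :
    ∃ L R : Fin (B.size t) → A, (∀ v, L v ∈ S) ∧ (∀ v, R v ∈ T) ∧
      Φ (B.eval π) = ∑ v, L v * R v := by
  have hmem : ∀ (U : Subalgebra F A) (x : A) (p : Polynomial F), x ∈ U → Polynomial.aeval x p ∈ U :=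
    fun U x p hx => by
      have := (Polynomial.aeval (⟨x, hx⟩ : U) p).2
      rwa [← Subalgebra.coe_val U, ← Polynomial.aeval_algHom_apply] at this
  obtain ⟨L, R, hL, hR, h⟩ := exists_sum_paths_eq_sum_mul S T B.size
    (fun i a b => Polynomial.aeval (Φ (MvPolynomial.X (π i))) (B.label i a b)) (fun _ => 1) t
    (fun _ => one_mem _) (fun i hi a b => hmem S _ _ (hS i hi))
    (fun i hi a b => hmem T _ _ (hT i hi))
  refine ⟨L, R, hL, hR, ?_⟩
  rw [← h, eval, map_sum]
  refine Finset.sum_congr rfl fun p _ => ?_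
  rw [one_mul, map_prod]
  exact Finset.prod_congr rfl fun i _ => (Polynomial.aeval_algHom_apply Φ _ _).symm

theorem size_le_width (B : RoABP F n) (t : Fin (n + 1)) : B.size t ≤ B.width :=
  Finset.le_sup (f := B.size) (Finset.mem_univ t)

/-- If a substitution that separates the variables read before layer `t` (which are mapped to
polynomials in the `x_e`, as coefficients) from the other ones (which are mapped to polynomials in
the `y_e`) turns the computed polynomial into `∏ e, ∑ j < d, (x_e y_e) ^ j`, then the width is at
least `d ^ r`, where `r` is the number of the `e`: the coefficients of the `x ^ α y ^ β` form an
identity matrix of that size, which factors through layer `t`. -/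
theorem pow_card_le_width {ι : Type*} [Fintype ι] [DecidableEq ι] (π : Equiv.Perm (Fin n))
    (B : RoABP F n) (t : Fin (n + 1)) (d : ℕ)
    (Φ : MvPolynomial (Fin n) F →ₐ[F] MvPolynomial ι (MvPolynomial ι F))
    (hS : ∀ i : Fin n, i.castSucc < t →
      ∃ p : MvPolynomial ι F, MvPolynomial.C p = Φ (MvPolynomial.X (π i)))
    (hT : ∀ i : Fin n, t ≤ i.castSucc →
      ∃ p : MvPolynomial ι F, MvPolynomial.map MvPolynomial.C p = Φ (MvPolynomial.X (π i)))
    (hΦ : Φ (B.eval π) = ∏ e : ι, ∑ j ∈ Finset.range d,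
      (MvPolynomial.C (MvPolynomial.X e) * MvPolynomial.X e) ^ j) :
    d ^ Fintype.card ι ≤ B.width := by
  let f : MvPolynomial ι F →ₐ[F] MvPolynomial ι (MvPolynomial ι F) :=
    IsScalarTower.toAlgHom F (MvPolynomial ι F) (MvPolynomial ι (MvPolynomial ι F))
  let g : MvPolynomial ι F →ₐ[F] MvPolynomial ι (MvPolynomial ι F) :=
    MvPolynomial.mapAlgHom (Algebra.ofId F (MvPolynomial ι F))
  obtain ⟨L, R, hL, hR, h⟩ := exists_map_eval_eq_sum_mul Φ f.range g.range π B t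
    (fun i hi => hS i hi) (fun i hi => hT i hi)
  choose l hl using hL
  choose r hr using hR
  let vec : (ι → Fin d) → ι →₀ ℕ := fun α => Finsupp.equivFunOnFinite.symm fun e => (α e : ℕ)
  have hvec : Function.Injective vec := by
    intro α β hαβ
    funext e
    exact Fin.ext (DFunLike.congr_fun hαβ e)
  have hmon : Φ (B.eval π) = ∑ γ : ι → Fin d,
      MvPolynomial.monomial (vec γ) (MvPolynomial.monomial (vec γ) (1 : F)) := by
    rw [hΦ]
    simp_rw [Finset.sum_range]
    rw [Finset.prod_univ_sum, Fintype.piFinset_univ]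
    refine Finset.sum_congr rfl fun γ _ => ?_
    simp_rw [mul_pow]
    rw [Finset.prod_mul_distrib]
    rw [MvPolynomial.monomial_eq, MvPolynomial.monomial_eq, MvPolynomial.C_1, one_mul,
      Finsupp.prod_fintype _ _ (fun _ => pow_zero _), Finsupp.prod_fintype _ _ (fun _ => pow_zero _),
      map_prod]
    simp only [map_pow]
    rfl
  have hcoeff : ∀ α β : ι → Fin d,
      MvPolynomial.coeff (vec α) (MvPolynomial.coeff (vec β) (Φ (B.eval π))) =
        if α = β then 1 else 0 := by
    intro α β
    rw [hmon, MvPolynomial.coeff_sum, Finset.sum_eq_single β]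
    · rw [MvPolynomial.coeff_monomial, if_pos rfl, MvPolynomial.coeff_monomial]
      simp only [hvec.eq_iff, eq_comm]
    · intro γ _ hγ
      rw [MvPolynomial.coeff_monomial, if_neg fun h => hγ (hvec h)]
    · exact fun h => absurd (Finset.mem_univ _) h
  have hprod : Matrix.of (fun (α : ι → Fin d) v => MvPolynomial.coeff (vec α) (l v)) *
      Matrix.of (fun v (β : ι → Fin d) => MvPolynomial.coeff (vec β) (r v)) = 1 := by
    ext α β
    rw [Matrix.mul_apply, Matrix.one_apply, ← hcoeff, h, MvPolynomial.coeff_sum,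
      MvPolynomial.coeff_sum]
    refine Finset.sum_congr rfl fun v _ => ?_
    rw [← hl, ← hr]
    change _ = MvPolynomial.coeff (vec α) (MvPolynomial.coeff (vec β)
      (MvPolynomial.C (l v) * MvPolynomial.map MvPolynomial.C (r v)))
    rw [MvPolynomial.coeff_C_mul, MvPolynomial.coeff_map, mul_comm (l v), MvPolynomial.coeff_C_mul]
    exact mul_comm _ _
  have h1 := congrArg Matrix.rank hprod
  rw [Matrix.rank_one, Fintype.card_fun, Fintype.card_fin] at h1
  rw [← h1]
  refine (Matrix.rank_mul_le_left _ _).trans ((Matrix.rank_le_card_width _).trans ?_)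
  rw [Fintype.card_fin]
  exact B.size_le_width t

/-- A sum of `W` products of univariate polynomials has a program of width `W` in every order: it
consists of `W` disjoint paths. -/
theorem exists_eval_eq_sum_prod (hn : 2 ≤ n) (W : ℕ) (hW : 0 < W) (q : ℕ → Fin n → Polynomial F)
    (π : Equiv.Perm (Fin n)) :
    ∃ B : RoABP F n, B.width ≤ W ∧ B.eval π =
      ∑ w ∈ Finset.range W, ∏ i : Fin n, Polynomial.aeval (MvPolynomial.X i) (q w i) := by
  -- the two ends of a layer of edges carry the same number, except where one of them is the only
  -- vertex, number `0`, of the first or the last layer: the larger number names the path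
  let B : RoABP F n :=
    { size := fun i => if i = 0 ∨ i = Fin.last n then 1 else W
      size_first := by simp
      size_last := by simp
      label := fun i a b =>
        if a.val = b.val ∨ i.castSucc = 0 ∨ i.succ = Fin.last n then q (max a.val b.val) (π i)
        else 0 }
  have hsize : ∀ i, B.size i = if i = 0 ∨ i = Fin.last n then 1 else W := fun i => rfl
  have hend : ∀ i (a : Fin (B.size i)), i = 0 ∨ i = Fin.last n → a.val = 0 := by
    intro i a hi
    have := a.2.trans_eq ((hsize i).trans (if_pos hi))
    lia
  have hlt : ∀ i (a : Fin (B.size i)), a.val < W := by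
    intro i a
    have := a.2.trans_eq (hsize i)
    split_ifs at this <;> lia
  have hpos : ∀ w < W, ∀ i : Fin (n + 1), (if i = 0 ∨ i = Fin.last n then 0 else w) < B.size i := by
    intro w hw i
    rw [hsize]
    split_ifs
    · exact one_pos
    · exact hw
  refine ⟨B, ?_, ?_⟩
  · refine Finset.sup_le fun i _ => ?_
    rw [hsize]
    split_ifs
    · exact hW
    · exact le_rfl
  · let path : (w : ℕ) → w ∈ Finset.range W → (i : Fin (n + 1)) → Fin (B.size i) :=
      fun w hw i => ⟨if i = 0 ∨ i = Fin.last n then 0 else w, hpos w (Finset.mem_range.1 hw) i⟩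
    rw [eval]
    symm
    let one : Fin (n + 1) := ⟨1, by lia⟩
    have hone : ¬ (one = 0 ∨ one = Fin.last n) := by
      simp only [one, Fin.ext_iff, Fin.val_last, Fin.val_zero]
      lia
    have hval : ∀ w hw i, (path w hw i).val = if i = 0 ∨ i = Fin.last n then 0 else w :=
      fun _ _ _ => rfl
    have hterm : ∀ w hw, ∏ i : Fin n, Polynomial.aeval (MvPolynomial.X i) (q w i) =
        ∏ i : Fin n, Polynomial.aeval (MvPolynomial.X (π i) : MvPolynomial (Fin n) F)
          (B.label i (path w hw i.castSucc) (path w hw i.succ)) := by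
      intro w hw
      rw [← Equiv.prod_comp π]
      refine Finset.prod_congr rfl fun i _ => ?_
      congr 1
      have hi := i.2
      have h1 : (path w hw i.castSucc).val = if i.val = 0 then 0 else w := by
        rw [hval w hw]
        refine if_congr ?_ rfl rfl
        simp only [Fin.ext_iff, Fin.val_last, Fin.val_zero, Fin.val_castSucc]
        lia
      have h2 : (path w hw i.succ).val = if i.val + 1 = n then 0 else w := by
        rw [hval w hw]
        refine if_congr ?_ rfl rfl
        simp only [Fin.ext_iff, Fin.val_last, Fin.val_zero, Fin.val_succ]
        lia
      have hlabel : B.label i (path w hw i.castSucc) (path w hw i.succ) =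
          if (path w hw i.castSucc).val = (path w hw i.succ).val ∨ i.castSucc = 0 ∨
              i.succ = Fin.last n then
            q (max (path w hw i.castSucc).val (path w hw i.succ).val) (π i) else 0 := rfl
      rw [hlabel, h1, h2, if_pos]
      · congr 1
        split_ifs <;> lia
      · simp only [Fin.ext_iff, Fin.val_last, Fin.val_zero, Fin.val_succ, Fin.val_castSucc]
        split_ifs <;> lia
    refine Finset.sum_bij_ne_zero (fun w hw _ => path w hw) (fun _ _ _ => Finset.mem_univ _)
      ?_ ?_ ?_
    · intro w hw _ w' hw' _ heq
      have := congrArg Fin.val (congrFun heq one)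
      rwa [hval w hw, hval w' hw', if_neg hone, if_neg hone] at this
    · intro p _ hp
      have hlab : ∀ i : Fin n, (p i.castSucc).val = (p i.succ).val ∨ i.castSucc = 0 ∨
          i.succ = Fin.last n := by
        intro i
        by_contra hi
        refine hp (Finset.prod_eq_zero (Finset.mem_univ i) ?_)
        have : B.label i (p i.castSucc) (p i.succ) = 0 := if_neg hi
        rw [this, map_zero]
      have hconst : ∀ (k : ℕ) (hk : k + 1 < n),
          (p ⟨k + 1, by lia⟩).val = (p one).val := by
        intro k
        induction k with
        | zero => intro _; rfl
        | succ k ih =>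
          intro hk
          rw [← ih (by lia)]
          rcases hlab ⟨k + 1, by lia⟩ with h | h | h
          · exact h.symm
          · exact absurd (congrArg Fin.val h) (by simp)
          · exact absurd (congrArg Fin.val h) (by simp; lia)
      have hpath : ∀ hw, p = path (p one).val hw := by
        intro hw
        funext i
        apply Fin.ext
        rw [hval _ hw]
        split_ifs with hi
        · exact hend i _ hi
        · have h0 : i.val ≠ 0 := fun h => hi (Or.inl (Fin.ext h))
          have h1 : i.val ≠ n := fun h => hi (Or.inr (Fin.ext h))
          have hlt' := i.2
          obtain ⟨k, hk⟩ : ∃ k, i.val = k + 1 := ⟨i.val - 1, by lia⟩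
          have hkn : k + 1 < n := by lia
          obtain rfl : i = ⟨k + 1, Nat.lt_succ_of_lt hkn⟩ := Fin.ext hk
          exact hconst k hkn
      have hw : (p one).val ∈ Finset.range W := Finset.mem_range.2 (hlt _ _)
      refine ⟨(p one).val, hw, ?_, (hpath hw).symm⟩
      rw [hterm _ hw, ← hpath hw]
      exact hp
    · exact fun w hw _ => hterm w hw

end RoABP

/-! ### Induced matchings across a cut and the lower bound -/

/-- Two pairs of vertices touch if an entry of the first is equal or adjacent to an entry of the
second. -/
def SimpleGraph.PairsTouch {V : Type*} (G : SimpleGraph V) (p q : V × V) : Prop :=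
  ∃ x y, (x = p.1 ∨ x = p.2) ∧ (y = q.1 ∨ y = q.2) ∧ (x = y ∨ G.Adj x y)

open Classical in
/-- In a graph of maximum degree `k`, the edges leaving a set contain an induced matching whose size
is a constant fraction of their number: a maximal one does, since it touches all these edges. -/
theorem SimpleGraph.exists_induced_matching {V : Type*} [Fintype V] (G : SimpleGraph V)
    (k : ℕ) (hk : ∀ v, G.degree v ≤ k) (S : Finset V) :
    ∃ M ⊆ G.interedges S Sᶜ, (∀ p ∈ M, ∀ q ∈ M, G.PairsTouch p q → p = q) ∧
      (G.interedges S Sᶜ).card ≤ 2 * (k + 1) * k * M.card := by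
  obtain ⟨M, hM, hmax⟩ := Finset.exists_max_image
    ((G.interedges S Sᶜ).powerset.filter fun M => ∀ p ∈ M, ∀ q ∈ M, G.PairsTouch p q → p = q)
    Finset.card ⟨∅, by simp⟩
  rw [Finset.mem_filter, Finset.mem_powerset] at hM
  refine ⟨M, hM.1, hM.2, ?_⟩
  have hsymm : ∀ p q, G.PairsTouch p q → G.PairsTouch q p := by
    rintro p q ⟨x, y, hx, hy, hxy⟩
    exact ⟨y, x, hy, hx, hxy.imp Eq.symm SimpleGraph.Adj.symm⟩
  -- an edge leaving `S` with one end `x` is determined by its other end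
  let N : V × V → Finset V := fun q => insert q.1 (G.neighborFinset q.1) ∪
    insert q.2 (G.neighborFinset q.2)
  let near : V × V → Finset (V × V) := fun q => (N q).biUnion fun x =>
    (G.neighborFinset x).image fun y => if x ∈ S then (x, y) else (y, x)
  have hins : ∀ v, (insert v (G.neighborFinset v)).card ≤ k + 1 := fun v =>
    (Finset.card_insert_le _ _).trans (Nat.succ_le_succ (hk v))
  have hnear : ∀ q, (near q).card ≤ 2 * (k + 1) * k := by
    intro q
    refine (Finset.card_biUnion_le_card_mul _ _ k fun x _ =>
      Finset.card_image_le.trans (hk x)).trans (Nat.mul_le_mul_right _ ?_)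
    refine (Finset.card_union_le _ _).trans ?_
    have := hins q.1
    have := hins q.2
    lia
  have hcover : G.interedges S Sᶜ ⊆ M.biUnion near := by
    intro p hp
    obtain ⟨hpS, hpS', hadj⟩ := (SimpleGraph.mem_interedges_iff G).1 hp
    rw [Finset.mem_compl] at hpS'
    obtain ⟨q, hq, hqp⟩ : ∃ q ∈ M, G.PairsTouch q p := by
      by_contra! hno
      have hpM : p ∉ M := fun h => hno p h ⟨p.1, p.1, Or.inl rfl, Or.inl rfl, Or.inl rfl⟩
      have := hmax (insert p M) (by
        rw [Finset.mem_filter, Finset.mem_powerset]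
        refine ⟨Finset.insert_subset hp hM.1, ?_⟩
        intro a ha b hb hab
        rcases Finset.mem_insert.1 ha with rfl | ha' <;>
          rcases Finset.mem_insert.1 hb with rfl | hb'
        · rfl
        · exact absurd (hsymm _ _ hab) (hno b hb')
        · exact absurd hab (hno a ha')
        · exact hM.2 a ha' b hb' hab)
      rw [Finset.card_insert_of_notMem hpM] at this
      lia
    refine Finset.mem_biUnion.2 ⟨q, hq, ?_⟩
    obtain ⟨y, x, hy, hx, hxy⟩ := hqp
    have hxN : x ∈ N q := by
      rw [Finset.mem_union, Finset.mem_insert, Finset.mem_insert, SimpleGraph.mem_neighborFinset,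
        SimpleGraph.mem_neighborFinset]
      rcases hy with rfl | rfl
      · exact Or.inl (hxy.imp Eq.symm id)
      · exact Or.inr (hxy.imp Eq.symm id)
    refine Finset.mem_biUnion.2 ⟨x, hxN, Finset.mem_image.2 ?_⟩
    rcases hx with rfl | rfl
    · exact ⟨p.2, (SimpleGraph.mem_neighborFinset _ _ _).2 hadj, by rw [if_pos hpS]⟩
    · exact ⟨p.1, (SimpleGraph.mem_neighborFinset _ _ _).2 hadj.symm, by rw [if_neg hpS']⟩
  refine (Finset.card_le_card hcover).trans ?_
  rw [mul_comm]
  exact Finset.card_biUnion_le_card_mul _ _ _ fun q _ => hnear q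

/-- In the order given by an injective map to `ℕ`, some initial segment has `s` elements. -/
theorem exists_card_filter_lt_eq {α : Type*} [Fintype α] (f : α → ℕ) (hf : Function.Injective f)
    (b s : ℕ) (hb : ∀ i, f i < b) (hs : s ≤ Fintype.card α) :
    ∃ t ≤ b, (Finset.univ.filter fun i => f i < t).card = s := by
  classical
  have hex : s ≤ (Finset.univ.filter fun i => f i < b).card := by
    rwa [Finset.filter_true_of_mem fun i _ => hb i]
  have hP : ∃ t, s ≤ (Finset.univ.filter fun i => f i < t).card := ⟨b, hex⟩
  refine ⟨Nat.find hP, Nat.find_min' hP hex, le_antisymm ?_ (Nat.find_spec hP)⟩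
  rcases h : Nat.find hP with _ | t
  · simp
  · have h1 := Nat.find_min hP (m := t) (by lia)
    have h2 : (Finset.univ.filter fun i => f i < t + 1) ⊆
        (Finset.univ.filter fun i => f i < t) ∪ Finset.univ.filter fun i => f i = t := by
      intro i
      simp only [Finset.mem_filter, Finset.mem_univ, true_and, Finset.mem_union]
      lia
    have h3 : (Finset.univ.filter fun i => f i = t).card ≤ 1 :=
      Finset.card_le_one.2 fun i hi j hj => hf
        ((Finset.mem_filter.1 hi).2.trans (Finset.mem_filter.1 hj).2.symm)
    have h4 := (Finset.card_le_card h2).trans (Finset.card_union_le _ _)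
    lia

section

variable {F : Type*} [Field F] {m : ℕ}

theorem edgeMonomial_mk (i j : Fin m) :
    edgeMonomial F s(i, j) = MvPolynomial.X i.castSucc * MvPolynomial.X j.castSucc := rfl

/-- Setting the variables outside an induced matching across the cut to `0` leaves a product over
the edges of the matching, so the rank of the coefficient matrix is exponential in their number. -/
theorem RoABP.pow_card_le_width_of_induced_matching (G : SimpleGraph (Fin m)) [DecidableRel G.Adj]
    {d : ℕ} (hd : 0 < d) (π : Equiv.Perm (Fin (m + 1))) (B : RoABP F (m + 1))
    (hB : B.eval π = hardFactor F G d) (t : Fin (m + 2)) (S : Finset (Fin m))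
    (hS : ∀ i, i ∈ S ↔ (π.symm i.castSucc).castSucc < t) (M : Finset (Fin m × Fin m))
    (hM : M ⊆ G.interedges S Sᶜ) (hind : ∀ p ∈ M, ∀ q ∈ M, G.PairsTouch p q → p = q) :
    d ^ M.card ≤ B.width := by
  classical
  have hM' : ∀ a : M, a.1.1 ∈ S ∧ a.1.2 ∉ S ∧ G.Adj a.1.1 a.1.2 := fun a => by
    have := (SimpleGraph.mem_interedges_iff G).1 (hM a.2)
    rwa [Finset.mem_compl] at this
  have hfst : ∀ a b : M, a.1.1 = b.1.1 → a = b := fun a b h =>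
    Subtype.ext (hind _ a.2 _ b.2 ⟨a.1.1, b.1.1, Or.inl rfl, Or.inl rfl, Or.inl h⟩)
  have hsnd : ∀ a b : M, a.1.2 = b.1.2 → a = b := fun a b h =>
    Subtype.ext (hind _ a.2 _ b.2 ⟨a.1.2, b.1.2, Or.inr rfl, Or.inr rfl, Or.inl h⟩)
  let ψ : Fin m → MvPolynomial M (MvPolynomial M F) := fun i =>
    if h : ∃ a : M, a.1.1 = i then MvPolynomial.C (MvPolynomial.X h.choose)
    else if h : ∃ a : M, a.1.2 = i then MvPolynomial.X h.choose else 0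
  have hψ1 : ∀ a : M, ψ a.1.1 = MvPolynomial.C (MvPolynomial.X a) := by
    intro a
    have h : ∃ b : M, b.1.1 = a.1.1 := ⟨a, rfl⟩
    simp only [ψ]
    rw [dif_pos h, hfst _ _ h.choose_spec]
  have hψ2 : ∀ a : M, ψ a.1.2 = MvPolynomial.X a := by
    intro a
    have h : ∃ b : M, b.1.2 = a.1.2 := ⟨a, rfl⟩
    have h' : ¬ ∃ b : M, b.1.1 = a.1.2 := fun ⟨b, hb⟩ => (hM' a).2.1 (hb ▸ (hM' b).1)
    simp only [ψ]
    rw [dif_neg h', dif_pos h, hsnd _ _ h.choose_spec]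
  have hψ0 : ∀ i, ψ i ≠ 0 → ∃ a : M, i = a.1.1 ∨ i = a.1.2 := by
    intro i hi
    by_contra! hno
    refine hi ?_
    simp only [ψ]
    rw [dif_neg fun ⟨a, ha⟩ => (hno a).1 ha.symm, dif_neg fun ⟨a, ha⟩ => (hno a).2 ha.symm]
  let Φ : MvPolynomial (Fin (m + 1)) F →ₐ[F] MvPolynomial M (MvPolynomial M F) :=
    MvPolynomial.aeval (Fin.snoc ψ 0)
  have hΦ : ∀ i : Fin m, Φ (MvPolynomial.X i.castSucc) = ψ i := fun i => by
    rw [MvPolynomial.aeval_X, Fin.snoc_castSucc (α := fun _ => _)]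
  have hΦz : Φ (MvPolynomial.X (Fin.last m)) = 0 := by
    rw [MvPolynomial.aeval_X, Fin.snoc_last (α := fun _ => _)]
  have hcard := RoABP.pow_card_le_width (ι := M) π B t d Φ ?_ ?_ ?_
  · rwa [Fintype.card_coe] at hcard
  · intro i hi
    rcases Fin.eq_castSucc_or_eq_last (π i) with ⟨v, hv⟩ | hv
    · rw [hv, hΦ]
      by_cases h : ψ v = 0
      · exact ⟨0, by rw [h, map_zero]⟩
      · have hvS : v ∈ S := (hS v).2 (by rwa [← hv, Equiv.symm_apply_apply])
        obtain ⟨a, rfl | rfl⟩ := hψ0 v h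
        · exact ⟨_, (hψ1 a).symm⟩
        · exact absurd hvS (hM' a).2.1
    · exact ⟨0, by rw [hv, hΦz, map_zero]⟩
  · intro i hi
    rcases Fin.eq_castSucc_or_eq_last (π i) with ⟨v, hv⟩ | hv
    · rw [hv, hΦ]
      by_cases h : ψ v = 0
      · exact ⟨0, by rw [h, map_zero]⟩
      · have hvS : v ∉ S := fun hvS => by
          have := (hS v).1 hvS
          rw [← hv, Equiv.symm_apply_apply] at this
          exact absurd this (not_lt.2 hi)
        obtain ⟨a, rfl | rfl⟩ := hψ0 v h
        · exact absurd (hM' a).1 hvS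
        · exact ⟨MvPolynomial.X a, by rw [hψ2, MvPolynomial.map_X]⟩
    · exact ⟨0, by rw [hv, hΦz, map_zero]⟩
  · rw [hB, hardFactor, map_add, hΦz, add_zero, graphQ, map_prod]
    simp only [map_sum, map_pow]
    symm
    refine Finset.prod_of_injOn (fun a : M => s(a.1.1, a.1.2)) ?_ ?_ ?_ ?_
    · intro a _ b _ hab
      rcases Sym2.eq_iff.1 hab with h | h
      · exact hfst a b h.1
      · exact absurd (h.1 ▸ (hM' a).1) (hM' b).2.1
    · intro a _
      exact SimpleGraph.mem_edgeFinset.2 (hM' a).2.2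
    · intro e he hne
      have hzero : Φ (edgeMonomial F e) = 0 := by
        induction e using Sym2.ind with
        | _ i j =>
          have hadj : G.Adj i j := SimpleGraph.mem_edgeFinset.1 he
          rw [edgeMonomial_mk, map_mul, hΦ, hΦ]
          by_contra h
          obtain ⟨a, ha⟩ := hψ0 i (left_ne_zero_of_mul h)
          obtain ⟨b, hb⟩ := hψ0 j (right_ne_zero_of_mul h)
          obtain rfl : a = b := Subtype.ext (hind _ a.2 _ b.2 ⟨i, j, ha, hb, Or.inr hadj⟩)
          refine hne ⟨a, Finset.mem_coe.2 (Finset.mem_univ a), ?_⟩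
          rcases ha with rfl | rfl <;> rcases hb with rfl | rfl
          · exact absurd rfl hadj.ne
          · rfl
          · exact Sym2.eq_swap
          · exact absurd rfl hadj.ne
      rw [hzero, Finset.sum_eq_single_of_mem 0 (Finset.mem_range.2 hd) fun j _ hj => zero_pow hj,
        pow_zero]
    · intro a _
      rw [edgeMonomial_mk, map_mul, hΦ, hΦ, hψ1, hψ2]

/-- The edge expansion provides an induced matching across the balanced cut in any order. -/
theorem RoABP.exists_pow_le_width (G : SimpleGraph (Fin m)) [DecidableRel G.Adj] {k : ℕ}
    (hk : ∀ v, G.degree v ≤ k) {h : ℝ} (hG : IsEdgeExpander G h) {d : ℕ} (hd : 0 < d)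
    (π : Equiv.Perm (Fin (m + 1))) (B : RoABP F (m + 1)) (hB : B.eval π = hardFactor F G d) :
    ∃ r : ℕ, h * (m / 2 : ℕ) ≤ 2 * (k + 1) * k * r ∧ d ^ r ≤ B.width := by
  classical
  obtain ⟨t, ht, hcard⟩ := exists_card_filter_lt_eq (fun i : Fin m => (π.symm i.castSucc).val)
    (fun i j hij => Fin.castSucc_injective m (π.symm.injective (Fin.ext hij))) (m + 1) (m / 2)
    (fun i => (π.symm i.castSucc).2) (by rw [Fintype.card_fin]; lia)
  set S := Finset.univ.filter fun i : Fin m => (π.symm i.castSucc).val < t with hS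
  obtain ⟨M, hM, hind, hMcard⟩ := G.exists_induced_matching k (fun v => by convert hk v) S
  refine ⟨M.card, ?_, RoABP.pow_card_le_width_of_induced_matching G hd π B hB
    ⟨t, by lia⟩ S (fun i => ?_) M (by convert hM) hind⟩
  · have h1 := hG S (by rw [Fintype.card_fin]; lia)
    rw [hcard] at h1
    refine h1.trans ?_
    have h2 : (G.interedges S Sᶜ).card ≤ 2 * (k + 1) * k * M.card := by convert hMcard
    exact_mod_cast h2
  · rw [hS, Finset.mem_filter, Fin.lt_def]
    exact ⟨fun h => h.2, fun h => ⟨Finset.mem_univ i, h⟩⟩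

end

/-! ### Sums of products of univariate polynomials and the upper bound -/

/-- A polynomial that is a sum of `W` products of univariate polynomials. -/
def IsSumOfUnivariateProducts {F : Type*} [Field F] {n : ℕ} (W : ℕ)
    (p : MvPolynomial (Fin n) F) : Prop :=
  ∃ (ι : Type) (_ : Fintype ι) (q : ι → Fin n → Polynomial F), Fintype.card ι = W ∧
    p = ∑ w, ∏ i, Polynomial.aeval (MvPolynomial.X i) (q w i)

namespace IsSumOfUnivariateProducts

variable {F : Type*} [Field F] {n : ℕ} {W W' : ℕ} {p p' : MvPolynomial (Fin n) F}

theorem add (hp : IsSumOfUnivariateProducts W p) (hp' : IsSumOfUnivariateProducts W' p') :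
    IsSumOfUnivariateProducts (W + W') (p + p') := by
  obtain ⟨ι, _, q, hc, rfl⟩ := hp
  obtain ⟨ι', _, q', hc', rfl⟩ := hp'
  refine ⟨ι ⊕ ι', inferInstance, Sum.elim q q', by rw [Fintype.card_sum, hc, hc'], ?_⟩
  rw [Fintype.sum_sum_type]
  rfl

theorem mul (hp : IsSumOfUnivariateProducts W p) (hp' : IsSumOfUnivariateProducts W' p') :
    IsSumOfUnivariateProducts (W * W') (p * p') := by
  obtain ⟨ι, _, q, hc, rfl⟩ := hp
  obtain ⟨ι', _, q', hc', rfl⟩ := hp'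
  refine ⟨ι × ι', inferInstance, fun w i => q w.1 i * q' w.2 i,
    by rw [Fintype.card_prod, hc, hc'], ?_⟩
  rw [Finset.sum_mul_sum, Fintype.sum_prod_type]
  refine Finset.sum_congr rfl fun w _ => Finset.sum_congr rfl fun w' _ => ?_
  rw [← Finset.prod_mul_distrib]
  exact Finset.prod_congr rfl fun i _ => (map_mul _ _ _).symm

theorem of_X (j : Fin n) :
    IsSumOfUnivariateProducts 1 (MvPolynomial.X j : MvPolynomial (Fin n) F) := by
  refine ⟨Unit, inferInstance, fun _ i => if i = j then Polynomial.X else 1, rfl, ?_⟩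
  rw [Fintype.sum_unique, Finset.prod_eq_single j]
  · beta_reduce
    rw [if_pos rfl, Polynomial.aeval_X]
  · intro i _ hi
    beta_reduce
    rw [if_neg hi, map_one]
  · exact fun h => absurd (Finset.mem_univ j) h

theorem one : IsSumOfUnivariateProducts 1 (1 : MvPolynomial (Fin n) F) :=
  ⟨Unit, inferInstance, fun _ _ => 1, rfl, by simp⟩

theorem neg_one [NeZero n] : IsSumOfUnivariateProducts 1 (-1 : MvPolynomial (Fin n) F) := by
  refine ⟨Unit, inferInstance, fun _ i => if i = 0 then -1 else 1, rfl, ?_⟩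
  rw [Fintype.sum_unique, Finset.prod_eq_single 0]
  · beta_reduce
    rw [if_pos rfl, map_neg, map_one]
  · intro i _ hi
    beta_reduce
    rw [if_neg hi, map_one]
  · exact fun h => absurd (Finset.mem_univ 0) h

theorem pow (hp : IsSumOfUnivariateProducts W p) (a : ℕ) :
    IsSumOfUnivariateProducts (W ^ a) (p ^ a) := by
  induction a with
  | zero => rw [pow_zero, pow_zero]; exact one
  | succ a ih => rw [pow_succ, pow_succ]; exact ih.mul hp

theorem prod {α : Type*} (s : Finset α) (f : α → MvPolynomial (Fin n) F)
    (h : ∀ a ∈ s, IsSumOfUnivariateProducts W (f a)) :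
    IsSumOfUnivariateProducts (W ^ s.card) (∏ a ∈ s, f a) := by
  classical
  induction s using Finset.induction_on with
  | empty => rw [Finset.card_empty, Finset.prod_empty, pow_zero]; exact one
  | insert a s ha ih =>
    rw [Finset.card_insert_of_notMem ha, Finset.prod_insert ha, pow_succ']
    exact (h a (Finset.mem_insert_self a s)).mul
      (ih fun b hb => h b (Finset.mem_insert_of_mem hb))

theorem exists_roABP (hp : IsSumOfUnivariateProducts W p) (hn : 2 ≤ n) (hW : 0 < W)
    (π : Equiv.Perm (Fin n)) : ∃ B : RoABP F n, B.eval π = p ∧ B.width ≤ W := by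
  obtain ⟨ι, _, q, hc, rfl⟩ := hp
  let e : Fin W ≃ ι := (Fintype.equivFinOfCardEq hc).symm
  obtain ⟨B, hw, hB⟩ := RoABP.exists_eval_eq_sum_prod hn W hW
    (fun w => if h : w < W then q (e ⟨w, h⟩) else 0) π
  refine ⟨B, ?_, hw⟩
  rw [hB, Finset.sum_range, ← e.sum_comp]
  refine Finset.sum_congr rfl fun w _ => Finset.prod_congr rfl fun i _ => ?_
  rw [dif_pos w.2]

end IsSumOfUnivariateProducts

section

variable {F : Type*} [Field F] {m : ℕ}

theorem isSumOfUnivariateProducts_edgeMonomial (e : Sym2 (Fin m)) :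
    IsSumOfUnivariateProducts 1 (edgeMonomial F e) := by
  induction e using Sym2.ind with
  | _ i j =>
    rw [edgeMonomial_mk]
    exact (IsSumOfUnivariateProducts.of_X i.castSucc).mul
      (IsSumOfUnivariateProducts.of_X j.castSucc)

theorem isSumOfUnivariateProducts_prod_edgeMonomial_pow_sub_one (E : Finset (Sym2 (Fin m)))
    (a : ℕ) : IsSumOfUnivariateProducts (2 ^ E.card) (∏ e ∈ E, (edgeMonomial F e ^ a - 1)) := by
  refine IsSumOfUnivariateProducts.prod E _ fun e _ => ?_
  have := ((isSumOfUnivariateProducts_edgeMonomial (F := F) e).pow a).add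
    IsSumOfUnivariateProducts.neg_one
  rwa [one_pow, ← sub_eq_add_neg] at this

variable (G : SimpleGraph (Fin m)) [DecidableRel G.Adj]

/-- Multiplication by the `x_i x_j - 1` turns the geometric sums in `Q_G` into binomials. -/
theorem easyProduct_eq (d : ℕ) :
    easyProduct F G d = ∏ e ∈ G.edgeFinset, (edgeMonomial F e ^ d - 1) +
      (∏ e ∈ G.edgeFinset, (edgeMonomial F e ^ 1 - 1)) * MvPolynomial.X (Fin.last m) := by
  rw [easyProduct, hardFactor, graphQ, add_mul, ← Finset.prod_mul_distrib]
  simp only [geom_sum_mul, pow_one]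
  rw [mul_comm (MvPolynomial.X (Fin.last m))]

theorem exists_roABP_easyProduct (hm : 1 ≤ m) (d : ℕ) (π : Equiv.Perm (Fin (m + 1))) :
    ∃ B : RoABP F (m + 1), B.eval π = easyProduct F G d ∧
      B.width ≤ 2 ^ (G.edgeFinset.card + 1) := by
  have h := (isSumOfUnivariateProducts_prod_edgeMonomial_pow_sub_one (F := F) G.edgeFinset d).add
    ((isSumOfUnivariateProducts_prod_edgeMonomial_pow_sub_one (F := F) G.edgeFinset 1).mul
      (IsSumOfUnivariateProducts.of_X (Fin.last m)))
  rw [← easyProduct_eq, mul_one, ← mul_two, ← pow_succ] at h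
  exact h.exists_roABP (by lia) (by positivity) π

/-! ### Irreducibility -/

theorem map_edgeMonomial_eq_self (e : Sym2 (Fin m))
    (φ : MvPolynomial (Fin (m + 1)) F →ₐ[F] MvPolynomial (Fin (m + 1)) F)
    (hφ : ∀ i : Fin m, φ (MvPolynomial.X i.castSucc) = MvPolynomial.X i.castSucc) :
    φ (edgeMonomial F e) = edgeMonomial F e := by
  induction e using Sym2.ind with
  | _ i j => rw [edgeMonomial_mk, map_mul, hφ, hφ]

/-- The automorphism `z ↦ Q_G + z` of the polynomial ring maps the prime `z` to `Q_G + z`. -/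
theorem irreducible_hardFactor (d : ℕ) : Irreducible (hardFactor F G d) := by
  let φ : MvPolynomial (Fin (m + 1)) F → MvPolynomial (Fin (m + 1)) F →ₐ[F]
      MvPolynomial (Fin (m + 1)) F := fun q =>
    MvPolynomial.aeval (Fin.snoc (fun i : Fin m => MvPolynomial.X i.castSucc)
      (q + MvPolynomial.X (Fin.last m)))
  have hφ : ∀ q (i : Fin m), φ q (MvPolynomial.X i.castSucc) = MvPolynomial.X i.castSucc :=
    fun q i => by rw [MvPolynomial.aeval_X, Fin.snoc_castSucc (α := fun _ => _)]
  have hφz : ∀ q, φ q (MvPolynomial.X (Fin.last m)) = q + MvPolynomial.X (Fin.last m) :=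
    fun q => by rw [MvPolynomial.aeval_X, Fin.snoc_last (α := fun _ => _)]
  have hQ : ∀ q, φ q (graphQ F G d) = graphQ F G d := by
    intro q
    rw [graphQ, map_prod]
    refine Finset.prod_congr rfl fun e _ => ?_
    rw [map_sum]
    refine Finset.sum_congr rfl fun a _ => ?_
    rw [map_pow, map_edgeMonomial_eq_self e _ (hφ q)]
  have hinv : ∀ q q', (∀ r, φ r q' = q') → q + q' = 0 → (φ q).comp (φ q') = AlgHom.id F _ := by
    intro q q' hq' hqq
    refine MvPolynomial.algHom_ext fun i => ?_
    rw [AlgHom.comp_apply, AlgHom.id_apply]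
    induction i using Fin.lastCases with
    | last => rw [hφz, map_add, hq', hφz, ← add_assoc, add_comm q', hqq, zero_add]
    | cast i => rw [hφ, hφ]
  let e : MvPolynomial (Fin (m + 1)) F ≃ₐ[F] MvPolynomial (Fin (m + 1)) F :=
    AlgEquiv.ofAlgHom (φ (graphQ F G d)) (φ (-graphQ F G d))
      (hinv _ _ (fun r => by rw [map_neg, hQ]) (add_neg_cancel _))
      (hinv _ _ hQ (neg_add_cancel _))
  have he : e (MvPolynomial.X (Fin.last m)) = hardFactor F G d := hφz _
  rw [← he, MulEquiv.irreducible_iff]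
  exact MvPolynomial.X_prime.irreducible

/-! ### Degrees -/

theorem totalDegree_edgeMonomial_pow_sub_one (e : Sym2 (Fin m)) {a : ℕ} (ha : 0 < a) :
    (edgeMonomial F e ^ a - 1).totalDegree = 2 * a := by
  induction e using Sym2.ind with
  | _ i j =>
    have h : (edgeMonomial F s(i, j) ^ a).totalDegree = 2 * a := by
      rw [edgeMonomial_mk, mul_pow, MvPolynomial.totalDegree_mul_of_isDomain
        (pow_ne_zero _ (MvPolynomial.X_ne_zero _)) (pow_ne_zero _ (MvPolynomial.X_ne_zero _)),
        MvPolynomial.totalDegree_X_pow, MvPolynomial.totalDegree_X_pow, two_mul]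
    rw [sub_eq_add_neg, MvPolynomial.totalDegree_add_eq_left_of_totalDegree_lt, h]
    rw [h, MvPolynomial.totalDegree_neg, MvPolynomial.totalDegree_one]
    lia

theorem totalDegree_prod_edgeMonomial_pow_sub_one (E : Finset (Sym2 (Fin m))) {a : ℕ}
    (ha : 0 < a) :
    (∏ e ∈ E, (edgeMonomial F e ^ a - 1)).totalDegree = 2 * a * E.card ∧
      ∏ e ∈ E, (edgeMonomial F e ^ a - 1) ≠ 0 := by
  have hne : ∀ e : Sym2 (Fin m), edgeMonomial F e ^ a - 1 ≠ 0 := by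
    intro e h
    have := totalDegree_edgeMonomial_pow_sub_one (F := F) e ha
    rw [h, MvPolynomial.totalDegree_zero] at this
    lia
  have hprod : ∀ E : Finset (Sym2 (Fin m)), ∏ e ∈ E, (edgeMonomial F e ^ a - 1) ≠ 0 :=
    fun E => Finset.prod_ne_zero_iff.2 fun e _ => hne e
  refine ⟨?_, hprod E⟩
  induction E using Finset.induction_on with
  | empty => simp
  | insert e E he ih =>
    rw [Finset.prod_insert he, MvPolynomial.totalDegree_mul_of_isDomain (hne e) (hprod E), ih,
      totalDegree_edgeMonomial_pow_sub_one e ha, Finset.card_insert_of_notMem he]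
    ring

theorem totalDegree_easyProduct {d : ℕ} (hd : 2 ≤ d) (hE : 0 < G.edgeFinset.card) :
    (easyProduct F G d).totalDegree = 2 * d * G.edgeFinset.card := by
  have h1 := totalDegree_prod_edgeMonomial_pow_sub_one (F := F) G.edgeFinset (a := d) (by lia)
  have h2 := totalDegree_prod_edgeMonomial_pow_sub_one (F := F) G.edgeFinset (a := 1) one_pos
  rw [easyProduct_eq, MvPolynomial.totalDegree_add_eq_left_of_totalDegree_lt, h1.1]
  rw [MvPolynomial.totalDegree_mul_of_isDomain h2.2 (MvPolynomial.X_ne_zero _), h1.1, h2.1,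
    MvPolynomial.totalDegree_X]
  nlinarith

theorem degreeOf_edgeMonomial_le {e : Sym2 (Fin m)} (he : e ∈ G.edgeFinset) (v : Fin m) :
    (edgeMonomial F e).degreeOf v.castSucc ≤ if v ∈ e then 1 else 0 := by
  induction e using Sym2.ind with
  | _ i j =>
    have hij : i ≠ j := (SimpleGraph.mem_edgeFinset.1 he : G.Adj i j).ne
    rw [edgeMonomial_mk]
    refine (MvPolynomial.degreeOf_mul_le _ _ _).trans ?_
    rw [MvPolynomial.degreeOf_X, MvPolynomial.degreeOf_X]
    simp only [Fin.castSucc_inj, Sym2.mem_iff]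
    split_ifs <;> grind

theorem degreeOf_last_edgeMonomial (e : Sym2 (Fin m)) :
    (edgeMonomial F e).degreeOf (Fin.last m) = 0 := by
  induction e using Sym2.ind with
  | _ i j =>
    rw [edgeMonomial_mk]
    refine Nat.le_zero.1 ((MvPolynomial.degreeOf_mul_le _ _ _).trans_eq ?_)
    rw [MvPolynomial.degreeOf_X_of_ne (Fin.castSucc_lt_last i).ne',
      MvPolynomial.degreeOf_X_of_ne (Fin.castSucc_lt_last j).ne']

theorem degreeOf_prod_edgeMonomial_pow_sub_one_le (E : Finset (Sym2 (Fin m))) (a : ℕ)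
    (i : Fin (m + 1)) :
    (∏ e ∈ E, (edgeMonomial F e ^ a - 1)).degreeOf i ≤
      a * ∑ e ∈ E, (edgeMonomial F e).degreeOf i := by
  refine (MvPolynomial.degreeOf_prod_le _ _ _).trans ?_
  rw [Finset.mul_sum]
  refine Finset.sum_le_sum fun e _ => ?_
  refine (MvPolynomial.degreeOf_sub_le _ _ _).trans ?_
  rw [MvPolynomial.degreeOf_one, max_eq_left (Nat.zero_le _)]
  exact MvPolynomial.degreeOf_pow_le _ _ _

theorem degreeOf_easyProduct_le {k : ℕ} (hk : ∀ v, G.degree v ≤ k) (hk' : 0 < k) {d : ℕ}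
    (hd : 0 < d) (i : Fin (m + 1)) : (easyProduct F G d).degreeOf i ≤ k * d := by
  have hkd : k ≤ k * d := Nat.le_mul_of_pos_right k hd
  have h1 := degreeOf_prod_edgeMonomial_pow_sub_one_le (F := F) G.edgeFinset d i
  have h2 := degreeOf_prod_edgeMonomial_pow_sub_one_le (F := F) G.edgeFinset 1 i
  have h3 := MvPolynomial.degreeOf_mul_le i
    (∏ e ∈ G.edgeFinset, (edgeMonomial F e ^ 1 - 1)) (MvPolynomial.X (Fin.last m))
  rw [easyProduct_eq]
  refine (MvPolynomial.degreeOf_add_le _ _ _).trans (max_le ?_ ?_) <;>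
    induction i using Fin.lastCases with
    | last =>
      simp only [degreeOf_last_edgeMonomial, Finset.sum_const_zero, mul_zero,
        MvPolynomial.degreeOf_X_self] at h1 h2 h3
      lia
    | cast v =>
      have hsum : ∑ e ∈ G.edgeFinset, (edgeMonomial F e).degreeOf v.castSucc ≤ k := by
        refine (Finset.sum_le_sum fun e he => degreeOf_edgeMonomial_le G he v).trans ?_
        rw [← Finset.card_filter, ← SimpleGraph.incidenceFinset_eq_filter,
          SimpleGraph.card_incidenceFinset_eq_degree]
        exact hk v
      rw [MvPolynomial.degreeOf_X_of_ne (Fin.castSucc_lt_last v).ne] at h3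
      nlinarith

end

/-! ### The separation -/

/-- The choice of the constants: since `D ≤ 16 (m + 1) d ≤ d ^ 5`, the left side is `d` to a power of
at most `40 (m + 1) / 4000000 ≤ m / 52224 ≤ r`. -/
theorem two_pow_rpow_le_pow {m d D r w : ℕ} (hm : 2 ≤ m) (hd : m + 1 ≤ d) (hD : 0 < D)
    (hDd : D ≤ 16 * (m + 1) * d) (hr : m ≤ 52224 * r) (hw : d ^ r ≤ w) :
    ((2 : ℝ) ^ (8 * (m + 1))) ^ (1 / 4000000 * Real.logb 2 (D : ℝ)) ≤ (w : ℝ) := by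
  have hd0 : (0 : ℝ) < d := by exact_mod_cast (show 0 < d by lia)
  have hlogd : 0 ≤ Real.logb 2 (d : ℝ) :=
    Real.logb_nonneg (by norm_num) (by exact_mod_cast (show 1 ≤ d by lia))
  have hD5 : D ≤ d ^ 5 := by
    have h1 : 3 ^ 3 ≤ d ^ 3 := Nat.pow_le_pow_left (by lia) 3
    calc D ≤ 16 * (m + 1) * d := hDd
      _ ≤ d ^ 3 * d * d := Nat.mul_le_mul_right _ (Nat.mul_le_mul (by lia) hd)
      _ = d ^ 5 := by ring
  have hlogD : Real.logb 2 (D : ℝ) ≤ 5 * Real.logb 2 (d : ℝ) := by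
    have : Real.logb 2 (D : ℝ) ≤ Real.logb 2 ((d : ℝ) ^ 5) :=
      Real.logb_le_logb_of_le (by norm_num) (by exact_mod_cast hD) (by exact_mod_cast hD5)
    rwa [Real.logb_pow] at this
  have hexp : ((8 * (m + 1) : ℕ) : ℝ) * (1 / 4000000 * Real.logb 2 (D : ℝ)) ≤
      Real.logb 2 (d : ℝ) * r := by
    have hm' : (2 : ℝ) ≤ m := by exact_mod_cast hm
    have hr' : (m : ℝ) ≤ 52224 * r := by exact_mod_cast hr
    push_cast
    calc 8 * ((m : ℝ) + 1) * (1 / 4000000 * Real.logb 2 (D : ℝ))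
        ≤ 8 * ((m : ℝ) + 1) * (1 / 4000000 * (5 * Real.logb 2 (d : ℝ))) := by gcongr
      _ = Real.logb 2 (d : ℝ) * (((m : ℝ) + 1) / 100000) := by ring
      _ ≤ Real.logb 2 (d : ℝ) * r := mul_le_mul_of_nonneg_left (by linarith) hlogd
  calc ((2 : ℝ) ^ (8 * (m + 1))) ^ (1 / 4000000 * Real.logb 2 (D : ℝ))
      = (2 : ℝ) ^ (((8 * (m + 1) : ℕ) : ℝ) * (1 / 4000000 * Real.logb 2 (D : ℝ))) := by
        rw [Real.rpow_mul (by norm_num) ((8 * (m + 1) : ℕ) : ℝ), Real.rpow_natCast]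
    _ ≤ (2 : ℝ) ^ (Real.logb 2 (d : ℝ) * r) := Real.rpow_le_rpow_of_exponent_le (by norm_num) hexp
    _ = (d : ℝ) ^ r := by
        rw [Real.rpow_mul (by norm_num), Real.rpow_logb (by norm_num) (by norm_num) hd0,
          Real.rpow_natCast]
    _ ≤ w := by exact_mod_cast hw

theorem mainTheorem1 :
    ∃ (k C : ℕ) (h c : ℝ), 0 < C ∧ 0 < h ∧ 0 < c ∧
      ∀ m : ℕ, 2 ≤ m →
        ∃ (G : SimpleGraph (Fin m)) (_ : DecidableRel G.Adj),
          G.maxDegree ≤ k ∧ IsEdgeExpander G h ∧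
          ∀ (F : Type*) [Field F] (d : ℕ), m + 1 ≤ d →
            -- the degree of the polynomial
            (easyProduct F G d).totalDegree = 2 * d * G.edgeFinset.card ∧
            d ≤ (easyProduct F G d).totalDegree ∧
            (easyProduct F G d).totalDegree ≤ k * (m + 1) * d ∧
            (∀ i, (easyProduct F G d).degreeOf i ≤ k * d) ∧
            -- it has a program of width `w = 2 ^ (C n)` in every order, where `n = m + 1`
            (∀ π : Equiv.Perm (Fin (m + 1)), ∃ B : RoABP F (m + 1),
              B.eval π = easyProduct F G d ∧ B.width ≤ 2 ^ (C * (m + 1))) ∧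
            -- an irreducible factor needs width `w ^ (c log (degree))` in every order
            Irreducible (hardFactor F G d) ∧ hardFactor F G d ∣ easyProduct F G d ∧
            (∀ (π : Equiv.Perm (Fin (m + 1))) (B : RoABP F (m + 1)),
              B.eval π = hardFactor F G d →
                ((2 : ℝ) ^ (C * (m + 1))) ^
                    (c * Real.logb 2 ((easyProduct F G d).totalDegree : ℝ)) ≤ (B.width : ℝ)) := by
  refine ⟨16, 8, 1 / 32, 1 / 4000000, by norm_num, by norm_num, by norm_num, fun m hm => ?_⟩
  obtain ⟨G, hdec, hdeg, hexp⟩ := exists_edgeExpander hm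
  refine ⟨G, hdec, G.maxDegree_le_of_forall_degree_le 16 hdeg, hexp,
    fun F _ d hd => ?_⟩
  -- twice the number of edges is the sum of the degrees
  have hEle : G.edgeFinset.card ≤ 8 * m := by
    have h1 := G.sum_degrees_eq_twice_card_edges
    have h2 := Finset.sum_le_card_nsmul Finset.univ (fun v => G.degree v) 16 fun v _ => hdeg v
    rw [Finset.card_univ, Fintype.card_fin, smul_eq_mul] at h2
    lia
  -- some edge leaves a singleton
  have hE : 0 < G.edgeFinset.card := by
    have h1 := hexp {⟨0, by lia⟩} (by rw [Finset.card_singleton, Fintype.card_fin]; lia)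
    rw [Finset.card_singleton] at h1
    have h2 : 0 < (G.interedges {⟨0, by lia⟩} {⟨0, by lia⟩}ᶜ).card := by
      have : (0 : ℝ) < ((G.interedges {⟨0, by lia⟩} {⟨0, by lia⟩}ᶜ).card : ℝ) :=
        lt_of_lt_of_le (by norm_num) h1
      exact_mod_cast this
    obtain ⟨p, hp⟩ := Finset.card_pos.1 h2
    exact Finset.card_pos.2
      ⟨s(p.1, p.2), SimpleGraph.mem_edgeFinset.2 ((SimpleGraph.mem_interedges_iff G).1 hp).2.2⟩
  have htd := totalDegree_easyProduct (F := F) G (d := d) (by lia) hE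
  have hle : (easyProduct F G d).totalDegree ≤ 16 * (m + 1) * d := by
    rw [htd]
    nlinarith
  have hge : d ≤ (easyProduct F G d).totalDegree := by
    rw [htd]
    nlinarith
  refine ⟨htd, hge, hle, degreeOf_easyProduct_le G hdeg (by norm_num) (by lia), fun π => ?_,
    irreducible_hardFactor G d, Dvd.intro _ rfl, fun π B hB => ?_⟩
  · obtain ⟨B, hB, hw⟩ := exists_roABP_easyProduct (F := F) G (by lia) d π
    exact ⟨B, hB, hw.trans (Nat.pow_le_pow_right (by norm_num) (by lia))⟩
  · -- `17408 = 32 * (2 * 17 * 16)`: the inverse expansion times the loss for an induced matching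
    obtain ⟨r, hr, hw⟩ := RoABP.exists_pow_le_width G hdeg hexp (by lia) π B hB
    have hr' : m / 2 ≤ 17408 * r := by
      have : ((m / 2 : ℕ) : ℝ) ≤ 17408 * r := by push_cast at hr ⊢; linarith
      exact_mod_cast this
    exact two_pow_rpow_le_pow hm hd (by lia) hle (by lia) hw
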